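/- Consider Bell scenarios in which Alice has $m_A$ settings, Bob has $m_B$ settings, and both have outcomes in $[d]$. A unique game is given by non-negative weights $\mu(x,y)$ (for example a probability distribution on input pairs) and permutations $\sigma_{x,y}$ of $[d]$; its Bell expression on a box $P$ is $$\mathbb{B}.\{P\}=\sum_{x=1}^{m_A}\sum_{y=1}^{m_B}\sum_{a,b=1}^{d}\mu(x,y)\,V(a,b|x,y)\,P(a,b|x,y),\qquad V(a,b|x,y)=\begin{cases}1,& b=\sigma_{x,y}(a)\\ 0,&\text{otherwise.}\end{cases}$$ Let $R_L(\mathbb{B})$ be its maximum over local deterministic boxes and $R_{NS}(\mathbb{B})$ its maximum over no-signaling boxes. The strong contradiction number $C^{(s)}_{\mathbb{B}}$ is the minimum cardinality of a set $S$ of settings of Bob such that the expression $\underline{\mathbb{B}}$ obtained from $\mathbb{B}$ by removing all terms with $y\in S$ satisfies $R_L(\underline{\mathbb{B}})=R_{NS}(\underline{\mathbb{B}})$ and, for every outcome $a$ and every setting $x$ of Alice, some local deterministic box that outputs $a$ on input $x$ attains $R_L(\underline{\mathbb{B}})$. Put $n=C^{(s)}_{\mathbb{B}}+1$. We say that $\mathbb{B}$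 obeys the monogamy relation if for every no-signaling box $P(a,b^1,\dots,b^n|x,y^1,\dots,y^n)$ shared by Alice and $n$ Bobs (the setting of any single party does not influence the joint distribution of the outcomes of all the others), $$\sum_{i=1}^{n}\mathcal{B}_{AB^i}\le n\,R_L(\mathbb{B}),$$ where $\mathcal{B}_{AB^i}$ is the value of $\mathbb{B}$ on the marginal $P(a,b^i|x,y^i)$. 1. For all $m_A,m_B,d$, every unique game for which there are non-negative numbers $\beta_{y,y'}$, independent of $x$, with $\mu(x,y)=\beta_{y,y'}\,\mu(x,y')$ for all $x,y,y'$ obeys the monogamy relation. The same holds for every free unique game, i.e. $\mu(x,y)=\mu^A(x)\mu^B(y)$ with $\mu^A,\mu^B\ge 0$. 2. For all $m_B,d$ and all non-negative weights $\mu$, every unique game with $m_A=2$ obeys the monogamy relation. -/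

import Mathlib

open scoped BigOperators

/-- A two-party Bell functional `𝔹(a,b,x,y)` (order of arguments: outcomes `a b`, settings `x y`),
with `mA`, `mB` settings for Alice and Bob and `d` outcomes for each of them. -/
abbrev BellFunctional (mA mB d : ℕ) : Type :=
  Fin d → Fin d → Fin mA → Fin mB → ℝ

/-- A two-party family of numbers `P(a,b|x,y)`. -/
abbrev Box (mA mB d : ℕ) : Type :=
  Fin d → Fin d → Fin mA → Fin mB → ℝ

/-- A family `P(a,b¹,…,bⁿ|x,y¹,…,yⁿ)` for Alice and `n` Bobs. -/
abbrev MultiBox (n mA mB d : ℕ) : Type :=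
  Fin d → (Fin n → Fin d) → Fin mA → (Fin n → Fin mB) → ℝ

/-- The value `𝔹.{P} = ∑_{x,y,a,b} 𝔹(a,b,x,y) P(a,b|x,y)`. -/
def bellValue {mA mB d : ℕ} (B : BellFunctional mA mB d) (P : Box mA mB d) : ℝ :=
  ∑ x, ∑ y, ∑ a, ∑ b, B a b x y * P a b x y

/-- The local deterministic box in which Alice answers `f x` and Bob answers `g y`. -/
def detBox {mA mB d : ℕ} (f : Fin mA → Fin d) (g : Fin mB → Fin d) : Box mA mB d :=
  fun a b x y => if a = f x ∧ b = g y then 1 else 0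

/-- Two-party no-signaling boxes. -/
structure IsNoSignalingBox {mA mB d : ℕ} (P : Box mA mB d) : Prop where
  nonneg : ∀ a b x y, 0 ≤ P a b x y
  sum_one : ∀ x y, ∑ a, ∑ b, P a b x y = 1
  alice : ∀ b x x' y, ∑ a, P a b x y = ∑ a, P a b x' y
  bob : ∀ a x y y', ∑ b, P a b x y = ∑ b, P a b x y'

/-- No-signaling boxes shared by Alice and `n` Bobs: the choice of setting of any single party
does not influence the joint outcome distribution of all the others. -/
structure IsNoSignalingMultiBox {n mA mB d : ℕ} (P : MultiBox n mA mB d) : Prop where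
  nonneg : ∀ a b x y, 0 ≤ P a b x y
  sum_one : ∀ x y, ∑ a, ∑ b, P a b x y = 1
  alice : ∀ b x x' y, ∑ a, P a b x y = ∑ a, P a b x' y
  bob : ∀ (i : Fin n) a b x y (y' : Fin mB),
    ∑ b', P a (Function.update b i b') x y =
      ∑ b', P a (Function.update b i b') x (Function.update y i y')

/-- The Alice–`Bⁱ` marginal `P(a,bⁱ|x,yⁱ)`. The other Bobs' outcomes are summed over; their
settings are irrelevant for a no-signaling box (see `bobMarginal_eq`), and are taken
equal to that of `Bⁱ`. -/
def bobMarginal {n mA mB d : ℕ} (P : MultiBox n mA mB d) (i : Fin n) : Box mA mB d :=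
  fun a b x y => ∑ b' : Fin n → Fin d, if b' i = b then P a b' x (fun _ => y) else 0

/-- Summing over all outcome tuples, grouped according to the coordinate `j`. -/
theorem sum_tuple_update_eq {n d : ℕ} (j : Fin n) (F G : (Fin n → Fin d) → ℝ)
    (h : ∀ b, ∑ b', F (Function.update b j b') = ∑ b', G (Function.update b j b')) :
    ∑ b, F b = ∑ b, G b := by
  have key : ∀ H : (Fin n → Fin d) → ℝ,
      ∑ b, ∑ b' : Fin d, H (Function.update b j b') = d * ∑ b, H b := by
    intro H
    rw [Finset.sum_comm, ← (Equiv.funSplitAt j (Fin d)).symm.sum_comp H,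
      Fintype.sum_prod_type, Finset.mul_sum]
    refine Finset.sum_congr rfl fun c _ => ?_
    rw [← (Equiv.funSplitAt j (Fin d)).symm.sum_comp, Fintype.sum_prod_type]
    have : ∀ (e : Fin d) (r : { k // k ≠ j } → Fin d),
        Function.update ((Equiv.funSplitAt j (Fin d)).symm (e, r)) j c =
          (Equiv.funSplitAt j (Fin d)).symm (c, r) := by
      intro e r
      ext k
      by_cases hk : k = j
      · subst hk; simp
      · simp [hk]
    simp [this]
  rcases Nat.eq_zero_or_pos d with rfl | hd
  · have : IsEmpty (Fin n → Fin 0) := ⟨fun b => (b j).elim0⟩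
    simp
  · have hd' : (d : ℝ) ≠ 0 := by positivity
    apply mul_left_cancel₀ hd'
    rw [← key F, ← key G]
    exact Finset.sum_congr rfl fun b _ => h b

/-- For a no-signaling box the Alice–`Bⁱ` marginal can be computed with any choice of settings for
the remaining Bobs. -/
theorem bobMarginal_eq {n mA mB d : ℕ} {P : MultiBox n mA mB d} (hP : IsNoSignalingMultiBox P)
    (i : Fin n) (a b : Fin d) (x : Fin mA) (y : Fin n → Fin mB) :
    bobMarginal P i a b x (y i) =
      ∑ b' : Fin n → Fin d, if b' i = b then P a b' x y else 0 := by
  have step : ∀ (z : Fin n → Fin mB) (j : Fin n) (w : Fin mB), j ≠ i →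
      (∑ b' : Fin n → Fin d, if b' i = b then P a b' x z else 0) =
        ∑ b' : Fin n → Fin d, if b' i = b then P a b' x (Function.update z j w) else 0 := by
    intro z j w hj
    apply sum_tuple_update_eq j
    intro c
    simp only [Function.update_of_ne hj.symm]
    by_cases hc : c i = b
    · simpa [hc] using hP.bob j a c x z w
    · simp [hc]
  have gen : ∀ s : Finset (Fin n), i ∉ s →
      (∑ b' : Fin n → Fin d, if b' i = b then P a b' x y else 0) =
        ∑ b' : Fin n → Fin d,
          if b' i = b then P a b' x (fun k => if k ∈ s then y i else y k) else 0 := by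
    intro s
    induction s using Finset.induction_on with
    | empty => simp
    | insert j s hjs ih =>
      intro his
      rw [Finset.mem_insert, not_or] at his
      rw [ih his.2, step _ j (y i) (Ne.symm his.1)]
      have : Function.update (fun k => if k ∈ s then y i else y k) j (y i) =
          fun k => if k ∈ insert j s then y i else y k := by
        ext k
        by_cases hk : k = j
        · subst hk; simp
        · simp [Finset.mem_insert, hk]
      rw [this]
  rw [gen (Finset.univ.erase i) (by simp)]
  have : (fun k => if k ∈ Finset.univ.erase i then y i else y k) = fun _ => y i := by
    ext k
    by_cases hk : k = i
    · subst hk; simp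
    · simp [hk]
  rw [this, bobMarginal]

/-- `R_L(𝔹)`: the maximum of `𝔹` over local deterministic boxes (a finite, and for `d ≥ 1`
nonempty, family). -/
noncomputable def localMax {mA mB d : ℕ} (B : BellFunctional mA mB d) : ℝ :=
  sSup {v | ∃ (f : Fin mA → Fin d) (g : Fin mB → Fin d), v = bellValue B (detBox f g)}

/-- `R_NS(𝔹)`: the maximum of `𝔹` over no-signaling boxes (a compact set, and for `d ≥ 1`
nonempty). -/
noncomputable def nsMax {mA mB d : ℕ} (B : BellFunctional mA mB d) : ℝ :=
  sSup {v | ∃ P : Box mA mB d, IsNoSignalingBox P ∧ v = bellValue B P}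

/-- The Bell functional obtained by removing the settings `y ∈ S` of Bob from the sum. -/
def removeSettings {mA mB d : ℕ} (B : BellFunctional mA mB d) (S : Finset (Fin mB)) :
    BellFunctional mA mB d :=
  fun a b x y => if y ∈ S then 0 else B a b x y

/-- After removal of Bob's settings in `S`, the local and no-signaling optima agree, and for every
outcome `a` and setting `x` of Alice the optimum is reached by some local deterministic box that
outputs `a` on input `x`. -/
def IsStrongContradictionSet {mA mB d : ℕ} (B : BellFunctional mA mB d)
    (S : Finset (Fin mB)) : Prop :=
  localMax (removeSettings B S) = nsMax (removeSettings B S) ∧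
    ∀ (a : Fin d) (x : Fin mA), ∃ (f : Fin mA → Fin d) (g : Fin mB → Fin d),
      f x = a ∧ bellValue (removeSettings B S) (detBox f g) = localMax (removeSettings B S)

/-- The strong contradiction number `C⁽ˢ⁾`: the least cardinality of such a set of settings. -/
noncomputable def strongContradictionNumber {mA mB d : ℕ} (B : BellFunctional mA mB d) : ℕ :=
  sInf {k | ∃ S : Finset (Fin mB), IsStrongContradictionSet B S ∧ S.card = k}

/-- The unique game with input weights `μ` and permutations `σ`:
`V(a,b|x,y) = 1` if `b = σ_{x,y}(a)`, and `0` otherwise. -/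
def uniqueGame {mA mB d : ℕ} (μ : Fin mA → Fin mB → ℝ)
    (σ : Fin mA → Fin mB → Equiv.Perm (Fin d)) : BellFunctional mA mB d :=
  fun a b x y => μ x y * (if b = σ x y a then 1 else 0)

/-- The monogamy relation `∑_{i=1}^{n} 𝓑_{ABⁱ} ≤ n R_L(𝔹)` for all no-signaling boxes shared by
Alice and `n` Bobs. -/
def MonogamyRelation {mA mB d : ℕ} (B : BellFunctional mA mB d) (n : ℕ) : Prop :=
  ∀ P : MultiBox n mA mB d, IsNoSignalingMultiBox P →
    ∑ i : Fin n, bellValue B (bobMarginal P i) ≤ (n : ℝ) * localMax B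

/-! ### Local strategies and the perfect no-signaling box -/

section

open Finset

variable {mA mB d : ℕ}

/-! Let `S` be a strong contradiction set of least size `C`. The `C + 1` Bobs and Bob's settings are
regrouped into `C + 1` rounds. In round `k`, Bob `k` handles every setting outside `S`, and each
setting in `S` goes to a different one of the other Bobs. Over all rounds every pair (Bob, setting)
occurs exactly once, so it suffices to bound each round by the local maximum. Within a round each
other Bob has one fixed setting, so one may condition on their outcomes. What remains is a
no-signaling family between Alice and Bob `k`, with predetermined answers to `S`: its value is
`hybridValue`, and the reduction is `monogamyRelation_of_hybridValue_le`.

The perfect no-signaling box shows that the optimum after removing `S` is the total remaining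
weight. Hence each answer of Alice extends to a local strategy winning every remaining question of
positive weight (`exists_perfect`), so that, where needed, the remaining permutations become
equality of answers after relabeling. The hybrid value is then at most a mixture of values of local
strategies. For free games (`hybridValue_le_of_free`) the mixture is driven by Bob's marginals; for
two settings of Alice (`hybridValue_le_of_two_settings`) by the overlap of her two marginals. -/

theorem bellValue_uniqueGame_detBox (μ : Fin mA → Fin mB → ℝ)
    (σ : Fin mA → Fin mB → Equiv.Perm (Fin d)) (f : Fin mA → Fin d) (g : Fin mB → Fin d) :
    bellValue (uniqueGame μ σ) (detBox f g) =
      ∑ x, ∑ y, μ x y * (if g y = σ x y (f x) then 1 else 0) := by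
  unfold bellValue uniqueGame detBox
  refine sum_congr rfl fun x _ => sum_congr rfl fun y _ => ?_
  rw [Finset.sum_eq_single (f x), Finset.sum_eq_single (g y)]
  · simp
  · intro b _ hb
    simp [hb]
  · simp
  · intro a _ ha
    simp [ha]
  · simp

theorem bellValue_detBox_le_localMax (B : BellFunctional mA mB d) (f : Fin mA → Fin d)
    (g : Fin mB → Fin d) : bellValue B (detBox f g) ≤ localMax B := by
  refine le_csSup ?_ ⟨f, g, rfl⟩
  refine ((Set.finite_range fun p : (Fin mA → Fin d) × (Fin mB → Fin d) =>
    bellValue B (detBox p.1 p.2)).subset ?_).bddAbove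
  rintro v ⟨f, g, rfl⟩
  exact ⟨(f, g), rfl⟩

theorem IsNoSignalingBox.le_one {P : Box mA mB d} (hP : IsNoSignalingBox P)
    (a b : Fin d) (x : Fin mA) (y : Fin mB) : P a b x y ≤ 1 := by
  rw [← hP.sum_one x y]
  calc P a b x y ≤ ∑ b, P a b x y :=
        single_le_sum (f := fun b => P a b x y) (fun b _ => hP.nonneg a b x y) (mem_univ b)
    _ ≤ ∑ a, ∑ b, P a b x y :=
        single_le_sum (f := fun a => ∑ b, P a b x y)
          (fun a _ => sum_nonneg fun b _ => hP.nonneg a b x y) (mem_univ a)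

theorem bellValue_le_nsMax (B : BellFunctional mA mB d) {P : Box mA mB d}
    (hP : IsNoSignalingBox P) : bellValue B P ≤ nsMax B := by
  refine le_csSup ⟨∑ x, ∑ y, ∑ a, ∑ b, |B a b x y|, ?_⟩ ⟨P, hP, rfl⟩
  rintro v ⟨P, hP, rfl⟩
  refine sum_le_sum fun x _ => sum_le_sum fun y _ => sum_le_sum fun a _ =>
    sum_le_sum fun b _ => ?_
  calc B a b x y * P a b x y ≤ |B a b x y| * P a b x y :=
        mul_le_mul_of_nonneg_right (le_abs_self _) (hP.nonneg a b x y)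
    _ ≤ |B a b x y| := mul_le_of_le_one_right (abs_nonneg _) (hP.le_one a b x y)

/-- The no-signaling box with uniform marginals that wins the unique game with certainty. -/
noncomputable def perfectBox (σ : Fin mA → Fin mB → Equiv.Perm (Fin d)) : Box mA mB d :=
  fun a b x y => if b = σ x y a then (d : ℝ)⁻¹ else 0

theorem isNoSignalingBox_perfectBox (hd : d ≠ 0) (σ : Fin mA → Fin mB → Equiv.Perm (Fin d)) :
    IsNoSignalingBox (perfectBox σ) where
  nonneg a b x y := by
    unfold perfectBox
    positivity
  sum_one x y := by simp [perfectBox, hd]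
  alice b x x' y := by
    simp [perfectBox, ← Equiv.symm_apply_eq]
  bob a x y y' := by simp [perfectBox]

theorem bellValue_uniqueGame_perfectBox (hd : d ≠ 0) (μ : Fin mA → Fin mB → ℝ)
    (σ : Fin mA → Fin mB → Equiv.Perm (Fin d)) :
    bellValue (uniqueGame μ σ) (perfectBox σ) = ∑ x, ∑ y, μ x y := by
  unfold bellValue uniqueGame perfectBox
  refine sum_congr rfl fun x _ => sum_congr rfl fun y _ => ?_
  simp only [mul_ite, ite_mul, mul_one, mul_zero, zero_mul]
  have : (d : ℝ) ≠ 0 := by exact_mod_cast hd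
  simp
  field_simp

theorem removeSettings_uniqueGame (μ : Fin mA → Fin mB → ℝ)
    (σ : Fin mA → Fin mB → Equiv.Perm (Fin d)) (S : Finset (Fin mB)) :
    removeSettings (uniqueGame μ σ) S = uniqueGame (fun x y => if y ∈ S then 0 else μ x y) σ := by
  ext a b x y
  by_cases hy : y ∈ S <;> simp [removeSettings, uniqueGame, hy]

/-- Once the settings of a strong contradiction set are removed, Alice's answer to any one of her
settings extends to a local strategy winning every remaining question of positive weight. -/
theorem IsStrongContradictionSet.exists_perfect {μ : Fin mA → Fin mB → ℝ}
    {σ : Fin mA → Fin mB → Equiv.Perm (Fin d)} {S : Finset (Fin mB)} (hμ : ∀ x y, 0 ≤ μ x y)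
    (hS : IsStrongContradictionSet (uniqueGame μ σ) S) (a : Fin d) (x₀ : Fin mA) :
    ∃ (f : Fin mA → Fin d) (g : Fin mB → Fin d), f x₀ = a ∧
      ∀ x y, y ∉ S → 0 < μ x y → g y = σ x y (f x) := by
  have hd : d ≠ 0 := (a.pos).ne'
  obtain ⟨heq, hex⟩ := hS
  obtain ⟨f, g, hf, hfg⟩ := hex a x₀
  refine ⟨f, g, hf, fun x y hy hxy => ?_⟩
  rw [heq, removeSettings_uniqueGame] at hfg
  have hle := bellValue_le_nsMax (uniqueGame (fun x y => if y ∈ S then 0 else μ x y) σ)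
    (isNoSignalingBox_perfectBox hd σ)
  rw [← hfg, bellValue_uniqueGame_perfectBox hd, bellValue_uniqueGame_detBox] at hle
  by_contra hne
  refine absurd hle (not_le.mpr ?_)
  have hterm : ∀ x y, (if y ∈ S then 0 else μ x y) * (if g y = σ x y (f x) then 1 else 0) ≤
      if y ∈ S then 0 else μ x y := by
    intro x y
    have := hμ x y
    split_ifs <;> simp [this]
  -- One lost question of positive weight would leave the local value strictly below the total
  -- weight, which the perfect box attains.
  refine sum_lt_sum (fun x _ => sum_le_sum fun y _ => hterm x y)
    ⟨x, mem_univ x, sum_lt_sum (fun y _ => hterm x y) ⟨y, mem_univ y, ?_⟩⟩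
  simp [hy, hne, hxy]

/-! ### Conditioned no-signaling families and hybrid values -/

/-- A no-signaling family of total mass `m`, with marginals `q` for Alice and `r` for Bob. -/
structure IsNoSignalingOfMass (Q : Box mA mB d) (q : Fin mA → Fin d → ℝ) (r : Fin mB → Fin d → ℝ)
    (m : ℝ) : Prop where
  nonneg : ∀ a b x y, 0 ≤ Q a b x y
  sum_alice : ∀ b x y, ∑ a, Q a b x y = r y b
  sum_bob : ∀ a x y, ∑ b, Q a b x y = q x a
  sum_left : ∀ x, ∑ a, q x a = m
  sum_right : ∀ y, ∑ b, r y b = m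

namespace IsNoSignalingOfMass

variable {Q : Box mA mB d} {q : Fin mA → Fin d → ℝ} {r : Fin mB → Fin d → ℝ} {m : ℝ}

theorem le_left (hQ : IsNoSignalingOfMass Q q r m) (a b : Fin d) (x : Fin mA) (y : Fin mB) :
    Q a b x y ≤ q x a := by
  rw [← hQ.sum_bob a x y]
  exact single_le_sum (f := fun b => Q a b x y) (fun b _ => hQ.nonneg a b x y) (mem_univ b)

theorem le_right (hQ : IsNoSignalingOfMass Q q r m) (a b : Fin d) (x : Fin mA) (y : Fin mB) :
    Q a b x y ≤ r y b := by
  rw [← hQ.sum_alice b x y]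
  exact single_le_sum (f := fun a => Q a b x y) (fun a _ => hQ.nonneg a b x y) (mem_univ a)

theorem left_nonneg [Nonempty (Fin mB)] (hQ : IsNoSignalingOfMass Q q r m) (x : Fin mA)
    (a : Fin d) : 0 ≤ q x a := by
  rw [← hQ.sum_bob a x (Classical.arbitrary _)]
  exact sum_nonneg fun b _ => hQ.nonneg a b x _

theorem right_nonneg [Nonempty (Fin mA)] (hQ : IsNoSignalingOfMass Q q r m) (y : Fin mB)
    (b : Fin d) : 0 ≤ r y b := by
  rw [← hQ.sum_alice b (Classical.arbitrary _) y]
  exact sum_nonneg fun a _ => hQ.nonneg a b _ y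

end IsNoSignalingOfMass

/-- The value of a unique game when Bob's answers to the settings in `S` are fixed to be `h`, and
the remaining answers are given by the family `Q`. -/
def hybridValue (μ : Fin mA → Fin mB → ℝ) (σ : Fin mA → Fin mB → Equiv.Perm (Fin d))
    (S : Finset (Fin mB)) (h : Fin mB → Fin d) (Q : Box mA mB d) : ℝ :=
  ∑ x, ∑ y, ∑ a, ∑ b,
    μ x y * (if (if y ∈ S then h y else b) = σ x y a then 1 else 0) * Q a b x y

/-- The weight that Alice wins against the fixed answers `h` to the settings in `S`, when she
answers `a` on input `x`. -/
def fixedWeight (μ : Fin mA → Fin mB → ℝ) (σ : Fin mA → Fin mB → Equiv.Perm (Fin d))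
    (S : Finset (Fin mB)) (h : Fin mB → Fin d) (x : Fin mA) (a : Fin d) : ℝ :=
  ∑ y ∈ S, μ x y * (if h y = σ x y a then 1 else 0)

theorem hybridValue_eq {Q : Box mA mB d} {q : Fin mA → Fin d → ℝ} {r : Fin mB → Fin d → ℝ} {m : ℝ}
    (hQ : IsNoSignalingOfMass Q q r m) (μ : Fin mA → Fin mB → ℝ)
    (σ : Fin mA → Fin mB → Equiv.Perm (Fin d)) (S : Finset (Fin mB)) (h : Fin mB → Fin d) :
    hybridValue μ σ S h Q =
      ∑ x, (∑ a, fixedWeight μ σ S h x a * q x a +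
        ∑ y ∈ Sᶜ, μ x y * ∑ a, Q a (σ x y a) x y) := by
  unfold hybridValue fixedWeight
  refine sum_congr rfl fun x _ => ?_
  rw [← sum_add_sum_compl S]
  congr 1
  · simp only [sum_mul]
    rw [sum_comm]
    refine sum_congr rfl fun a _ => sum_congr rfl fun y hy => ?_
    simp only [if_pos hy, ← mul_sum, hQ.sum_bob]
  · refine sum_congr rfl fun y hy => ?_
    rw [mul_sum]
    refine sum_congr rfl fun a _ => ?_
    simp [if_neg (mem_compl.mp hy)]

theorem sum_fixedWeight_add_le_localMax (μ : Fin mA → Fin mB → ℝ)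
    (σ : Fin mA → Fin mB → Equiv.Perm (Fin d)) (S : Finset (Fin mB)) (h k : Fin mB → Fin d)
    (f : Fin mA → Fin d) :
    ∑ x, (fixedWeight μ σ S h x (f x) +
        ∑ y ∈ Sᶜ, μ x y * (if k y = σ x y (f x) then 1 else 0)) ≤
      localMax (uniqueGame μ σ) := by
  refine le_of_eq_of_le ?_
    (bellValue_detBox_le_localMax _ f fun y => if y ∈ S then h y else k y)
  rw [bellValue_uniqueGame_detBox]
  refine sum_congr rfl fun x _ => ?_
  rw [← sum_add_sum_compl S]
  unfold fixedWeight
  congr 1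
  · exact sum_congr rfl fun y hy => by simp [hy]
  · exact sum_congr rfl fun y hy => by simp [mem_compl.mp hy]

/-- The old value of coordinate `j` is overwritten, so each tuple is counted `d` times. Summing over
full tuples avoids a separate type for the outcomes of the other Bobs; the price is this factor. -/
theorem sum_tuple_update {n : ℕ} (j : Fin n) (H : (Fin n → Fin d) → ℝ) :
    ∑ c, ∑ b : Fin d, H (Function.update c j b) = d * ∑ c, H c := by
  rw [sum_comm, ← (Equiv.funSplitAt j (Fin d)).symm.sum_comp H, Fintype.sum_prod_type, mul_sum]
  refine sum_congr rfl fun b _ => ?_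
  rw [← (Equiv.funSplitAt j (Fin d)).symm.sum_comp, Fintype.sum_prod_type]
  have : ∀ (e : Fin d) (r : { k // k ≠ j } → Fin d),
      Function.update ((Equiv.funSplitAt j (Fin d)).symm (e, r)) j b =
        (Equiv.funSplitAt j (Fin d)).symm (b, r) := by
    intro e r
    ext k
    by_cases hk : k = j
    · subst hk; simp
    · simp [hk]
  simp [this]

/-- Fixing the other Bobs' settings and outcomes leaves an unnormalized two-party no-signaling
family. The masses add up to `d` rather than 1 because `c i` is a dummy coordinate. -/
theorem exists_isNoSignalingOfMass_update {n : ℕ} [Nonempty (Fin mA)] [Nonempty (Fin mB)]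
    {P : MultiBox n mA mB d} (hP : IsNoSignalingMultiBox P) (i : Fin n) (s : Fin n → Fin mB) :
    ∃ m : (Fin n → Fin d) → ℝ, ∑ c, m c = d ∧ ∀ c, ∃ q r,
      IsNoSignalingOfMass
        (fun a b x y => P a (Function.update c i b) x (Function.update s i y)) q r (m c) := by
  let x₀ : Fin mA := Classical.arbitrary _
  let y₀ : Fin mB := Classical.arbitrary _
  have hb : ∀ c a x y, ∑ b, P a (Function.update c i b) x (Function.update s i y) =
      ∑ b, P a (Function.update c i b) x (Function.update s i y₀) := by
    intro c a x y
    simpa using hP.bob i a c x (Function.update s i y) y₀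
  have ha : ∀ b x y, ∑ a, P a b x y = ∑ a, P a b x₀ y := fun b x y => hP.alice b x x₀ y
  refine ⟨fun c => ∑ b, ∑ a, P a (Function.update c i b) x₀ (Function.update s i y₀), ?_, ?_⟩
  · rw [sum_tuple_update i fun c => ∑ a, P a c x₀ (Function.update s i y₀), sum_comm,
      hP.sum_one, mul_one]
  · intro c
    refine ⟨fun x a => ∑ b, P a (Function.update c i b) x (Function.update s i y₀),
      fun y b => ∑ a, P a (Function.update c i b) x₀ (Function.update s i y),
      fun a b x y => hP.nonneg _ _ _ _, fun b x y => ha _ _ _, fun a x y => hb _ _ _ _, ?_, ?_⟩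
    · intro x
      rw [sum_comm]
      exact sum_congr rfl fun b _ => ha _ _ _
    · intro y
      exact sum_comm.trans ((sum_congr rfl fun a _ => hb _ _ _ _).trans sum_comm)

/-! ### Degenerate cases and attainment of the minimum -/

theorem monogamyRelation_of_isEmpty (B : BellFunctional mA mB d) (n : ℕ)
    (h : IsEmpty (Fin mA) ∨ IsEmpty (Fin mB) ∨ IsEmpty (Fin d)) : MonogamyRelation B n := by
  have hzero : ∀ P, bellValue B P = 0 := by
    intro P
    rcases h with h | h | h <;> simp [bellValue]
  intro P _
  simp only [hzero, sum_const_zero]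
  refine mul_nonneg (Nat.cast_nonneg n) (Real.sSup_nonneg ?_)
  rintro v ⟨f, g, rfl⟩
  exact (hzero _).ge

/-- Removing all of Bob's settings leaves the zero functional, so the infimum is over a nonempty set
and is attained. -/
theorem exists_strongContradictionSet [Nonempty (Fin d)] (B : BellFunctional mA mB d) :
    ∃ S, IsStrongContradictionSet B S ∧ S.card = strongContradictionNumber B := by
  have hd : d ≠ 0 := (Classical.arbitrary (Fin d)).pos.ne'
  have hzero : ∀ P, bellValue (removeSettings B univ) P = 0 := by
    intro P
    simp [bellValue, removeSettings]
  have hL : localMax (removeSettings B univ) = 0 := by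
    unfold localMax
    simp only [hzero, exists_const]
    simp
  have hNS : nsMax (removeSettings B univ) = 0 := by
    unfold nsMax
    simp only [hzero, exists_and_right]
    have hne : ∃ P : Box mA mB d, IsNoSignalingBox P :=
      ⟨_, isNoSignalingBox_perfectBox hd fun _ _ => Equiv.refl _⟩
    simp [hne]
  refine Nat.sInf_mem (s := {k | ∃ S, IsStrongContradictionSet B S ∧ S.card = k})
    ⟨_, univ, ⟨hL.trans hNS.symm, fun a x => ?_⟩, rfl⟩
  exact ⟨fun _ => a, fun _ => Classical.arbitrary _, rfl, by rw [hzero, hL]⟩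

/-! ### Regrouping the Bobs into rounds -/

/-- The contribution of Bob's setting `y` to the value of the game played with the `i`-th Bob. -/
def settingValue {n : ℕ} (B : BellFunctional mA mB d) (P : MultiBox n mA mB d) (i : Fin n)
    (y : Fin mB) : ℝ :=
  ∑ x, ∑ a, ∑ b, B a b x y * bobMarginal P i a b x y

theorem settingValue_uniqueGame_eq {n : ℕ} {P : MultiBox n mA mB d} (hP : IsNoSignalingMultiBox P)
    (μ : Fin mA → Fin mB → ℝ) (σ : Fin mA → Fin mB → Equiv.Perm (Fin d)) (i : Fin n)
    (s : Fin n → Fin mB) :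
    settingValue (uniqueGame μ σ) P i (s i) =
      ∑ x, ∑ a, ∑ c : Fin n → Fin d,
        μ x (s i) * (if c i = σ x (s i) a then 1 else 0) * P a c x s := by
  unfold settingValue uniqueGame
  refine sum_congr rfl fun x _ => sum_congr rfl fun a _ => ?_
  simp only [bobMarginal_eq hP, mul_sum]
  rw [sum_comm]
  refine sum_congr rfl fun c _ => ?_
  rw [Finset.sum_eq_single (c i)]
  · simp
  · intro b _ hb
    simp [hb.symm]
  · simp

/-- Conditioning on the outcomes of all Bobs but the `i`-th one turns the value of the game in which
the settings in `S` are delegated to the other Bobs into a sum of hybrid values. -/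
theorem card_mul_sum_settingValue {n : ℕ} {P : MultiBox n mA mB d} (hP : IsNoSignalingMultiBox P)
    (μ : Fin mA → Fin mB → ℝ) (σ : Fin mA → Fin mB → Equiv.Perm (Fin d)) {S : Finset (Fin mB)}
    {i : Fin n} {s : Fin n → Fin mB} {e : Fin mB → Fin n} (he : ∀ y, y ∉ S → e y = i)
    (hne : ∀ y ∈ S, e y ≠ i) (hs : ∀ y ∈ S, s (e y) = y) :
    d * ∑ y, settingValue (uniqueGame μ σ) P (e y) y =
      ∑ c : Fin n → Fin d, hybridValue μ σ S (fun y => c (e y))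
        (fun a b x y => P a (Function.update c i b) x (Function.update s i y)) := by
  have hse : ∀ y, Function.update s i y (e y) = y := by
    intro y
    by_cases hy : y ∈ S
    · rw [Function.update_of_ne (hne y hy), hs y hy]
    · rw [he y hy, Function.update_self]
  have hval : ∀ y, settingValue (uniqueGame μ σ) P (e y) y = ∑ x, ∑ a, ∑ c : Fin n → Fin d,
      μ x y * (if c (e y) = σ x y a then 1 else 0) * P a c x (Function.update s i y) := by
    intro y
    have := settingValue_uniqueGame_eq hP μ σ (e y) (Function.update s i y)
    simpa only [hse y] using this
  have hce : ∀ y (c : Fin n → Fin d) b,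
      Function.update c i b (e y) = if y ∈ S then c (e y) else b := by
    intro y c b
    by_cases hy : y ∈ S
    · rw [Function.update_of_ne (hne y hy), if_pos hy]
    · rw [he y hy, Function.update_self, if_neg hy]
  simp only [hval, mul_sum (s := (univ : Finset (Fin mB))), mul_sum (s := (univ : Finset (Fin mA))),
    mul_sum (s := (univ : Finset (Fin d)))]
  simp only [← sum_tuple_update i, hce]
  unfold hybridValue
  rw [sum_comm (s := (univ : Finset (Fin n → Fin d))), sum_comm]
  refine sum_congr rfl fun x _ => ?_
  rw [sum_comm (s := (univ : Finset (Fin n → Fin d)))]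
  refine sum_congr rfl fun y _ => ?_
  rw [sum_comm (s := (univ : Finset (Fin n → Fin d)))]

/-- Bob 0 keeps the settings outside `S`; the other `C` Bobs are matched bijectively with `S`. The
value of `s 0` is arbitrary. -/
theorem exists_delegation {C : ℕ} [Nonempty (Fin mB)] {S : Finset (Fin mB)} (hS : S.card = C) :
    ∃ (e : Fin mB → Fin (C + 1)) (s : Fin (C + 1) → Fin mB), (∀ y, y ∉ S → e y = 0) ∧
      (∀ y ∈ S, e y ≠ 0) ∧ ∀ y ∈ S, s (e y) = y := by
  let E : S ≃ Fin C := S.equivFinOfCardEq hS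
  refine ⟨fun y => if hy : y ∈ S then (E ⟨y, hy⟩).succ else 0,
    Fin.cons (Classical.arbitrary _) fun j => (E.symm j : Fin mB), ?_, ?_, ?_⟩
  · intro y hy
    simp [hy]
  · intro y hy
    simp [hy]
  · intro y hy
    simp [hy]

theorem monogamyRelation_of_hybridValue_le (μ : Fin mA → Fin mB → ℝ)
    (σ : Fin mA → Fin mB → Equiv.Perm (Fin d))
    (H : ∀ S, IsStrongContradictionSet (uniqueGame μ σ) S → [Nonempty (Fin mA)] →
      [Nonempty (Fin mB)] → ∀ h Q q r m, IsNoSignalingOfMass Q q r m →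
        hybridValue μ σ S h Q ≤ m * localMax (uniqueGame μ σ)) :
    MonogamyRelation (uniqueGame μ σ) (strongContradictionNumber (uniqueGame μ σ) + 1) := by
  rcases isEmpty_or_nonempty (Fin mA) with hA | hA
  · exact monogamyRelation_of_isEmpty _ _ (.inl hA)
  rcases isEmpty_or_nonempty (Fin mB) with hB | hB
  · exact monogamyRelation_of_isEmpty _ _ (.inr (.inl hB))
  rcases isEmpty_or_nonempty (Fin d) with hD | hD
  · exact monogamyRelation_of_isEmpty _ _ (.inr (.inr hD))
  have hd : (0 : ℝ) < d := by exact_mod_cast (Classical.arbitrary (Fin d)).pos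
  obtain ⟨S, hS, hcard⟩ := exists_strongContradictionSet (uniqueGame μ σ)
  generalize strongContradictionNumber (uniqueGame μ σ) = C at hcard
  obtain ⟨e, s, he, hne, hs⟩ := exists_delegation hcard
  intro P hP
  have hround : ∀ k, ∑ y, settingValue (uniqueGame μ σ) P (e y + k) y ≤
      localMax (uniqueGame μ σ) := by
    intro k
    refine le_of_mul_le_mul_left ?_ hd
    -- Round `k` is the cyclic shift by `k`, in `Fin (C + 1)`, of the basic delegation.
    rw [card_mul_sum_settingValue hP μ σ (S := S) (i := k) (s := fun j => s (j - k))
      (e := fun y => e y + k) (fun y hy => by simp [he y hy]) (fun y hy => by simp [hne y hy])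
      (fun y hy => by simp [hs y hy])]
    obtain ⟨m, hm, hQ⟩ := exists_isNoSignalingOfMass_update hP k fun j => s (j - k)
    rw [← hm, sum_mul]
    refine sum_le_sum fun c _ => ?_
    obtain ⟨q, r, hc⟩ := hQ c
    exact H S hS _ _ q r _ hc
  calc ∑ i, bellValue (uniqueGame μ σ) (bobMarginal P i)
      = ∑ i, ∑ y, settingValue (uniqueGame μ σ) P i y :=
        sum_congr rfl fun i _ => sum_comm
    _ = ∑ k, ∑ y, settingValue (uniqueGame μ σ) P (e y + k) y := by
        rw [sum_comm, sum_comm (s := (univ : Finset (Fin (C + 1))))]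
        exact sum_congr rfl fun y _ => (Equiv.sum_comp (Equiv.addLeft (e y))
          fun i => settingValue (uniqueGame μ σ) P i y).symm
    _ ≤ ∑ _k : Fin (C + 1), localMax (uniqueGame μ σ) := sum_le_sum fun k _ => hround k
    _ = ((C + 1 : ℕ) : ℝ) * localMax (uniqueGame μ σ) := by simp

/-! ### Free games -/

/-- Write `M (w q + s) = (w + M) s + w (M q - s)` and raise the second `w` to `W`. As `M q` and `ρ`
have equal sums, `M q` may be replaced by `ρ`, and `ρ` then splits into the nonnegative parts `s`
and `ρ - s`. -/
theorem sum_mul_add_le {ι : Type*} [Fintype ι] {w q ρ s : ι → ℝ} {M m W : ℝ}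
    (hρ : ∑ c, ρ c = M * m) (hq : ∑ c, q c = m)
    (hsq : ∀ c, s c ≤ M * q c) (hsρ : ∀ c, s c ≤ ρ c) (hs : ∀ c, 0 ≤ s c) (hw : ∀ c, w c ≤ W) :
    M * (∑ c, w c * q c + ∑ c, s c) ≤ ∑ c, ρ c * max (w c + M) W := by
  have h1 : M * (∑ c, w c * q c + ∑ c, s c) ≤ ∑ c, ((w c + M) * s c + W * (M * q c - s c)) := by
    rw [← sum_add_distrib, mul_sum]
    refine sum_le_sum fun c _ => ?_
    nlinarith [mul_nonneg (sub_nonneg.mpr (hw c)) (sub_nonneg.mpr (hsq c))]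
  have h2 : ∑ c, ((w c + M) * s c + W * (M * q c - s c)) =
      ∑ c, ((w c + M) * s c + W * (ρ c - s c)) := by
    simp only [sum_add_distrib, ← mul_sum, sum_sub_distrib, hρ, hq]
  refine (h1.trans h2.le).trans (sum_le_sum fun c _ => ?_)
  have h3 := mul_le_mul_of_nonneg_right (le_max_left (w c + M) W) (hs c)
  have h4 := mul_le_mul_of_nonneg_right (le_max_right (w c + M) W) (sub_nonneg.mpr (hsρ c))
  linarith

theorem sum_mul_le_of_forall_le {ι : Type*} [Fintype ι] {w q : ι → ℝ} {m W : ℝ}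
    (hq : ∑ c, q c = m) (hq0 : ∀ c, 0 ≤ q c) (hw : ∀ c, w c ≤ W) : ∑ c, w c * q c ≤ m * W := by
  rw [← hq, sum_mul]
  exact sum_le_sum fun c _ => (mul_le_mul_of_nonneg_right (hw c) (hq0 c)).trans_eq (mul_comm _ _)

/-- If only the settings in `S` carry weight, the hybrid value is bounded by the local maximum. -/
theorem hybridValue_le_of_weight_eq_zero [Nonempty (Fin mB)] {μ : Fin mA → Fin mB → ℝ}
    {σ : Fin mA → Fin mB → Equiv.Perm (Fin d)} {S : Finset (Fin mB)}
    (hμ : ∀ x, ∀ y ∉ S, μ x y = 0) (h : Fin mB → Fin d) {Q : Box mA mB d}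
    {q : Fin mA → Fin d → ℝ} {r : Fin mB → Fin d → ℝ} {m : ℝ} (hm : 0 ≤ m)
    (hQ : IsNoSignalingOfMass Q q r m) :
    hybridValue μ σ S h Q ≤ m * localMax (uniqueGame μ σ) := by
  have : Nonempty (Fin d) := ⟨h (Classical.arbitrary _)⟩
  choose f hf using fun x => Finite.exists_max (fixedWeight μ σ S h x)
  have hloc := sum_fixedWeight_add_le_localMax μ σ S h h f
  have hzero : ∀ x (z : Fin mB → ℝ), ∑ y ∈ Sᶜ, μ x y * z y = 0 := fun x z =>
    sum_eq_zero fun y hy => by rw [hμ x y (mem_compl.mp hy), zero_mul]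
  rw [hybridValue_eq hQ]
  simp only [hzero, add_zero] at hloc ⊢
  refine le_trans ?_ (mul_le_mul_of_nonneg_left hloc hm)
  rw [mul_sum]
  exact sum_le_sum fun x _ => sum_mul_le_of_forall_le (hQ.sum_left x) (hQ.left_nonneg x) (hf x)

theorem hybridValue_le_of_free [Nonempty (Fin mA)] [Nonempty (Fin mB)] {μA : Fin mA → ℝ}
    {μB : Fin mB → ℝ} (hA : ∀ x, 0 ≤ μA x) (hB : ∀ y, 0 ≤ μB y)
    {σ : Fin mA → Fin mB → Equiv.Perm (Fin d)} {S : Finset (Fin mB)}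
    (hS : IsStrongContradictionSet (uniqueGame (fun x y => μA x * μB y) σ) S)
    (h : Fin mB → Fin d) {Q : Box mA mB d} {q : Fin mA → Fin d → ℝ} {r : Fin mB → Fin d → ℝ}
    {m : ℝ} (hQ : IsNoSignalingOfMass Q q r m) :
    hybridValue (fun x y => μA x * μB y) σ S h Q ≤
      m * localMax (uniqueGame (fun x y => μA x * μB y) σ) := by
  have : Nonempty (Fin d) := ⟨h (Classical.arbitrary _)⟩
  have hm : 0 ≤ m := by
    rw [← hQ.sum_left (Classical.arbitrary _)]
    exact sum_nonneg fun a _ => hQ.left_nonneg _ a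
  have hμ : ∀ x y, 0 ≤ μA x * μB y := fun x y => mul_nonneg (hA x) (hB y)
  by_cases hsupp : ∃ x₁, ∃ y₁ ∉ S, 0 < μA x₁ * μB y₁
  swap
  · push Not at hsupp
    exact hybridValue_le_of_weight_eq_zero
      (fun x y hy => le_antisymm (hsupp x y hy) (hμ x y)) h hm hQ
  obtain ⟨x₁, y₁, hy₁, hxy⟩ := hsupp
  have hx₁ : 0 < μA x₁ := (hA x₁).lt_of_ne' (left_ne_zero_of_mul hxy.ne')
  have hyB₁ : 0 < μB y₁ := (hB y₁).lt_of_ne' (right_ne_zero_of_mul hxy.ne')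
  -- The perfect strategies are indexed by Bob's answer `c` to `y₁`. Since the weight is a product,
  -- `y₁` has positive weight with every relevant `x`, so `c ↦ F c x` is a permutation.
  choose F G hF hFG using fun c => hS.exists_perfect hμ ((σ x₁ y₁).symm c) x₁
  have hG₁ : ∀ c, G c y₁ = c := fun c => by rw [hFG c x₁ y₁ hy₁ hxy, hF, Equiv.apply_symm_apply]
  have hFx : ∀ x, 0 < μA x → ∀ c, F c x = (σ x y₁).symm c := fun x hx c => by
    rw [Equiv.eq_symm_apply, ← hFG c x y₁ hy₁ (mul_pos hx hyB₁), hG₁]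
  have hGy : ∀ y ∉ S, 0 < μB y → ∀ c, G c y = σ x₁ y ((σ x₁ y₁).symm c) := fun y hy hyB c => by
    rw [hFG c x₁ y hy (mul_pos hx₁ hyB), hF]
  set M := ∑ y ∈ Sᶜ, μB y with hMdef
  have hM : 0 < M := sum_pos' (fun y _ => hB y) ⟨y₁, mem_compl.mpr hy₁, hyB₁⟩
  let w : Fin mA → Fin d → ℝ := fixedWeight (fun _ y => μB y) σ S h
  have hw : ∀ x a, fixedWeight (fun x y => μA x * μB y) σ S h x a = μA x * w x a := by
    intro x a
    simp only [w, fixedWeight, mul_sum, mul_assoc]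
  choose top htop using fun x => Finite.exists_max (w x)
  -- The mixing weights: how much Bob's averaged marginals agree with the strategy `G c`. They do
  -- not depend on `x`, so one mixture serves all of Alice's settings.
  let ρ : Fin d → ℝ := fun c => ∑ y ∈ Sᶜ, μB y * r y (G c y)
  have hρ0 : ∀ c, 0 ≤ ρ c := fun c =>
    sum_nonneg fun y _ => mul_nonneg (hB y) (hQ.right_nonneg y _)
  have hρ : ∑ c, ρ c = M * m := by
    rw [sum_comm, hMdef, sum_mul]
    refine sum_congr rfl fun y hy => ?_
    rw [← mul_sum]
    rcases (hB y).eq_or_lt' with h0 | hpos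
    · simp [h0]
    · rw [← hQ.sum_right y, ← (((σ x₁ y₁).symm.trans (σ x₁ y)).sum_comp (r y))]
      simp [hGy y (mem_compl.mp hy) hpos]
  have hlocal : ∀ c, ∑ x, μA x * max (w x (F c x) + M) (w x (top x)) ≤
      localMax (uniqueGame (fun x y => μA x * μB y) σ) := by
    intro c
    -- Bob plays `G c`. For each `x`, Alice either follows `F c` and wins all remaining questions,
    -- or abandons them for her best answer against `h`.
    refine le_trans ?_ (sum_fixedWeight_add_le_localMax (fun x y => μA x * μB y) σ S h (G c)
      fun x => if w x (top x) ≤ w x (F c x) + M then F c x else top x)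
    refine sum_le_sum fun x _ => ?_
    split_ifs with hle
    · rw [max_eq_left hle, hw, mul_add, hMdef, mul_sum]
      refine add_le_add le_rfl (sum_le_sum fun y hy => ?_)
      rcases (hμ x y).eq_or_lt' with h0 | hpos
      · simp [h0]
      · simp [hFG c x y (mem_compl.mp hy) hpos]
    · rw [max_eq_right (not_le.mp hle).le, hw]
      exact le_add_of_nonneg_right
        (sum_nonneg fun y _ => mul_nonneg (hμ x y) (by split_ifs <;> norm_num))
  have hx : ∀ x, M * (∑ a, fixedWeight (fun x y => μA x * μB y) σ S h x a * q x a +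
      ∑ y ∈ Sᶜ, μA x * μB y * ∑ a, Q a (σ x y a) x y) ≤
        μA x * ∑ c, ρ c * max (w x (F c x) + M) (w x (top x)) := by
    intro x
    rcases (hA x).eq_or_lt' with h0 | hpos
    · simp [hw, h0]
    have key := sum_mul_add_le (w := fun c => w x (F c x)) (q := fun c => q x (F c x))
      (s := fun c => ∑ y ∈ Sᶜ, μB y * Q (F c x) (G c y) x y) (W := w x (top x)) hρ
      (by
        simp only [hFx x hpos]
        rw [(σ x y₁).symm.sum_comp (q x), hQ.sum_left])
      (fun c => by
        rw [hMdef, sum_mul]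
        exact sum_le_sum fun y _ => mul_le_mul_of_nonneg_left (hQ.le_left _ _ _ _) (hB y))
      (fun c => sum_le_sum fun y _ => mul_le_mul_of_nonneg_left (hQ.le_right _ _ _ _) (hB y))
      (fun c => sum_nonneg fun y _ => mul_nonneg (hB y) (hQ.nonneg _ _ _ _))
      (fun c => htop x _)
    refine le_of_eq_of_le ?_ (mul_le_mul_of_nonneg_left key hpos.le)
    have e1 : ∑ c, w x (F c x) * q x (F c x) = ∑ a, w x a * q x a := by
      simp only [hFx x hpos]
      exact (σ x y₁).symm.sum_comp fun a => w x a * q x a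
    have e2 : ∑ c, ∑ y ∈ Sᶜ, μB y * Q (F c x) (G c y) x y =
        ∑ y ∈ Sᶜ, μB y * ∑ a, Q a (σ x y a) x y := by
      rw [sum_comm]
      refine sum_congr rfl fun y hy => ?_
      rw [← mul_sum]
      rcases (hB y).eq_or_lt' with h0 | hyB
      · simp [h0]
      · rw [← (σ x y₁).symm.sum_comp fun a => Q a (σ x y a) x y]
        simp only [hFG _ x y (mem_compl.mp hy) (mul_pos hpos hyB), hFx x hpos]
    rw [e1, e2]
    simp only [hw, mul_assoc, ← mul_sum]
    ring
  refine le_of_mul_le_mul_left ?_ hM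
  rw [hybridValue_eq hQ, mul_sum]
  calc _ ≤ ∑ x, μA x * ∑ c, ρ c * max (w x (F c x) + M) (w x (top x)) :=
        sum_le_sum fun x _ => hx x
    _ = ∑ c, ρ c * ∑ x, μA x * max (w x (F c x) + M) (w x (top x)) := by
        simp only [mul_sum]
        rw [sum_comm]
        exact sum_congr rfl fun c _ => sum_congr rfl fun x _ => by ring
    _ ≤ ∑ c, ρ c * localMax (uniqueGame (fun x y => μA x * μB y) σ) :=
        sum_le_sum fun c _ => mul_le_mul_of_nonneg_left (hlocal c) (hρ0 c)
    _ = _ := by rw [← sum_mul, hρ, mul_assoc]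

/-! ### Two settings for Alice -/

theorem min_add_min_le (a b r : ℝ) : min a r + min b r ≤ min a b + r := by
  rcases le_total a b with h | h
  · rw [min_eq_left h]
    exact add_le_add (min_le_left _ _) (min_le_right _ _)
  · rw [min_eq_right h, add_comm]
    exact add_le_add (min_le_left _ _) (min_le_right _ _)

/-- Two agreement sums with a common Bob are traded for the overlap of Alice's marginals. -/
theorem weighted_agreement_le {ι : Type*} [Fintype ι] {u v q₁ q₂ t r : ι → ℝ} {m α β : ℝ}
    (hα : 0 ≤ α) (hβ : 0 ≤ β) (hr : ∑ c, r c = m) (hu : ∀ c, u c ≤ min (q₁ c) (r c))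
    (hv : ∀ c, v c ≤ min (q₂ c) (r c)) (ht : ∀ c, t c = min (q₁ c) (q₂ c)) :
    α * ∑ c, u c + β * ∑ c, v c ≤ m * max α β + min α β * ∑ c, t c := by
  rw [← hr, sum_mul, mul_sum, mul_sum, mul_sum, ← sum_add_distrib, ← sum_add_distrib]
  refine sum_le_sum fun c _ => ?_
  have h := min_add_min_le (q₁ c) (q₂ c) (r c)
  have hu₁ := hu c
  have hv₁ := hv c
  have hur := hu₁.trans (min_le_right _ _)
  have hvr := hv₁.trans (min_le_right _ _)
  rw [ht c]
  -- If `α ≤ β`, write `α u + β v = α (u + v) + (β - α) v`; the other case is symmetric.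
  rcases le_total α β with hle | hle
  · rw [max_eq_right hle, min_eq_left hle]
    nlinarith [mul_le_mul_of_nonneg_left hvr (sub_nonneg.mpr hle),
      mul_le_mul_of_nonneg_left (show u c + v c ≤ min (q₁ c) (q₂ c) + r c by linarith) hα]
  · rw [max_eq_left hle, min_eq_right hle]
    nlinarith [mul_le_mul_of_nonneg_left hur (sub_nonneg.mpr hle),
      mul_le_mul_of_nonneg_left (show u c + v c ≤ min (q₁ c) (q₂ c) + r c by linarith) hβ]

/-- A perfect strategy starting from `a` has a single answer to setting 1, which every doubly
weighted `y` outside `S` must force. Without such a `y` any permutation will do. -/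
theorem exists_common_relabeling {μ : Fin 2 → Fin mB → ℝ}
    {σ : Fin 2 → Fin mB → Equiv.Perm (Fin d)} (hμ : ∀ x y, 0 ≤ μ x y) {S : Finset (Fin mB)}
    (hS : IsStrongContradictionSet (uniqueGame μ σ) S) :
    ∃ τ : Equiv.Perm (Fin d), ∀ y ∉ S, 0 < μ 0 y → 0 < μ 1 y →
      ∀ a, σ 1 y (τ a) = σ 0 y a := by
  by_cases hex : ∃ y₁ ∉ S, 0 < μ 0 y₁ ∧ 0 < μ 1 y₁
  · obtain ⟨y₁, hy₁, h₀, h₁⟩ := hex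
    refine ⟨(σ 0 y₁).trans (σ 1 y₁).symm, fun y hy hp₀ hp₁ a => ?_⟩
    obtain ⟨f, g, hf, hfg⟩ := hS.exists_perfect hμ a 0
    have hτ : (σ 1 y₁).symm (σ 0 y₁ a) = f 1 := by
      rw [Equiv.symm_apply_eq, ← hfg 1 y₁ hy₁ h₁, hfg 0 y₁ hy₁ h₀, hf]
    rw [Equiv.trans_apply, hτ, ← hfg 1 y hy hp₁, hfg 0 y hy hp₀, hf]
  · refine ⟨Equiv.refl _, fun y hy hp₀ hp₁ => absurd ⟨y, hy, hp₀, hp₁⟩ hex⟩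

theorem hybridValue_le_of_two_settings [Nonempty (Fin mB)] {μ : Fin 2 → Fin mB → ℝ}
    {σ : Fin 2 → Fin mB → Equiv.Perm (Fin d)} (hμ : ∀ x y, 0 ≤ μ x y) {S : Finset (Fin mB)}
    (hS : IsStrongContradictionSet (uniqueGame μ σ) S) (h : Fin mB → Fin d) {Q : Box 2 mB d}
    {q : Fin 2 → Fin d → ℝ} {r : Fin mB → Fin d → ℝ} {m : ℝ} (hQ : IsNoSignalingOfMass Q q r m) :
    hybridValue μ σ S h Q ≤ m * localMax (uniqueGame μ σ) := by
  have : Nonempty (Fin d) := ⟨h (Classical.arbitrary _)⟩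
  obtain ⟨τ, hτ⟩ := exists_common_relabeling hμ hS
  set R := localMax (uniqueGame μ σ)
  let w := fixedWeight μ σ S h
  let t : Fin d → ℝ := fun a => min (q 0 a) (q 1 (τ a))
  have ht0 : ∀ a, 0 ≤ t a := fun a => le_min (hQ.left_nonneg 0 a) (hQ.left_nonneg 1 _)
  let N := ∑ y ∈ Sᶜ, max (μ 0 y) (μ 1 y)
  let K := ∑ y ∈ Sᶜ, min (μ 0 y) (μ 1 y)
  have hsplit : hybridValue μ σ S h Q = ∑ a, w 0 a * q 0 a + ∑ a, w 1 a * q 1 a +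
      ∑ y ∈ Sᶜ, (μ 0 y * ∑ a, Q a (σ 0 y a) 0 y + μ 1 y * ∑ a, Q a (σ 1 y a) 1 y) := by
    rw [hybridValue_eq hQ, Fin.sum_univ_two, sum_add_distrib]
    ring
  have hupper : hybridValue μ σ S h Q ≤
      ∑ a, w 0 a * q 0 a + ∑ a, w 1 a * q 1 a + (m * N + K * ∑ a, t a) := by
    rw [hsplit]
    refine add_le_add le_rfl ?_
    rw [mul_sum, sum_mul, ← sum_add_distrib]
    refine sum_le_sum fun y hy => ?_
    have hle : ∀ x, ∑ a, Q a (σ x y a) x y ≤ m := fun x => by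
      rw [← hQ.sum_left x]
      exact sum_le_sum fun a _ => hQ.le_left _ _ _ _
    rcases (hμ 0 y).eq_or_lt' with h₀ | h₀
    · rw [h₀, max_eq_right (hμ 1 y), min_eq_left (hμ 1 y)]
      linarith [mul_le_mul_of_nonneg_left (hle 1) (hμ 1 y)]
    rcases (hμ 1 y).eq_or_lt' with h₁ | h₁
    · rw [h₁, max_eq_left (hμ 0 y), min_eq_right (hμ 0 y)]
      linarith [mul_le_mul_of_nonneg_left (hle 0) (hμ 0 y)]
    rw [← Equiv.sum_comp τ fun a => Q a (σ 1 y a) 1 y]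
    refine weighted_agreement_le (q₁ := q 0) (q₂ := fun a => q 1 (τ a))
      (r := fun a => r y (σ 0 y a)) (hμ 0 y) (hμ 1 y) ?_ ?_ ?_ fun a => rfl
    · rw [Equiv.sum_comp (σ 0 y) (r y), hQ.sum_right]
    · exact fun a => le_min (hQ.le_left _ _ _ _) (hQ.le_right _ _ _ _)
    · intro a
      simp only [hτ y (mem_compl.mp hy) h₀ h₁]
      exact le_min (hQ.le_left _ _ _ _) (hQ.le_right _ _ _ _)
  have hlocal : ∀ a₀ a₁, w 0 a₀ + w 1 a₁ + N + K * (if a₁ = τ a₀ then 1 else 0) ≤ R := by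
    intro a₀ a₁
    -- Outside `S`, Bob satisfies whichever of Alice's settings has the larger weight; the smaller
    -- weight is also won when her answers match under `τ`.
    refine le_trans ?_ (sum_fixedWeight_add_le_localMax μ σ S h
      (fun y => if μ 1 y ≤ μ 0 y then σ 0 y a₀ else σ 1 y a₁) ![a₀, a₁])
    rw [Fin.sum_univ_two]
    have hy : N + K * (if a₁ = τ a₀ then 1 else 0) ≤
        ∑ y ∈ Sᶜ, μ 0 y * (if (if μ 1 y ≤ μ 0 y then σ 0 y a₀ else σ 1 y a₁) = σ 0 y a₀
            then 1 else 0) +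
          ∑ y ∈ Sᶜ, μ 1 y * (if (if μ 1 y ≤ μ 0 y then σ 0 y a₀ else σ 1 y a₁) = σ 1 y a₁
            then 1 else 0) := by
      rw [sum_mul, ← sum_add_distrib, ← sum_add_distrib]
      refine sum_le_sum fun y hy => ?_
      have hn₀ := hμ 0 y
      have hn₁ := hμ 1 y
      by_cases hτa : a₁ = τ a₀
      · rcases hn₀.eq_or_lt' with h₀ | h₀
        · rw [h₀, max_eq_right hn₁, min_eq_left hn₁]
          rcases hn₁.eq_or_lt' with h₁ | h₁
          · simp [h₁]
          · simp [not_le.mpr h₁]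
        rcases hn₁.eq_or_lt' with h₁ | h₁
        · rw [h₁, max_eq_left hn₀, min_eq_right hn₀]
          simp [hn₀]
        simp [hτa, hτ y (mem_compl.mp hy) h₀ h₁, max_add_min]
      · rw [if_neg hτa, mul_zero, add_zero]
        split_ifs with hle <;> simp_all [le_of_lt]
    refine le_of_eq_of_le (add_assoc _ _ _)
      ((add_le_add_right hy (w 0 a₀ + w 1 a₁)).trans_eq (add_add_add_comm _ _ _ _))
  -- Alice's marginals are split into the overlap `t`, carried by matched pairs `(a, τ a)`, and
  -- residues of equal mass `m - ∑ t`. The pairs are bounded by the matched local strategies, the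
  -- residues by the best answers `b₀`, `b₁`.
  obtain ⟨b₀, hb₀⟩ := Finite.exists_max (w 0)
  obtain ⟨b₁, hb₁⟩ := Finite.exists_max (w 1)
  have hK : 0 ≤ K := sum_nonneg fun y _ => le_min (hμ 0 y) (hμ 1 y)
  have hbest : w 0 b₀ + w 1 b₁ ≤ R - N := by
    have := hlocal b₀ b₁
    have : 0 ≤ K * (if b₁ = τ b₀ then 1 else 0 : ℝ) := mul_nonneg hK (by split_ifs <;> norm_num)
    linarith
  have hq₀ : ∑ a, (q 0 a - t a) = m - ∑ a, t a := by rw [sum_sub_distrib, hQ.sum_left]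
  have hq₁ : ∑ a, (q 1 (τ a) - t a) = m - ∑ a, t a := by
    rw [sum_sub_distrib, Equiv.sum_comp τ (q 1), hQ.sum_left]
  have hres₀ := sum_mul_le_of_forall_le hq₀ (fun a => sub_nonneg.mpr (min_le_left _ _)) hb₀
  have hres₁ := sum_mul_le_of_forall_le (w := fun a => w 1 (τ a)) hq₁
    (fun a => sub_nonneg.mpr (min_le_right _ _)) (fun a => hb₁ _)
  have hdiag : ∑ a, (w 0 a + w 1 (τ a) + K) * t a ≤ (∑ a, t a) * (R - N) :=
    sum_mul_le_of_forall_le rfl ht0 fun a => by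
      have := hlocal a (τ a)
      rw [if_pos rfl] at this
      linarith
  have hrest : 0 ≤ m - ∑ a, t a := by
    rw [← hq₀]
    exact sum_nonneg fun a _ => sub_nonneg.mpr (min_le_left _ _)
  have hcomb := mul_le_mul_of_nonneg_left hbest hrest
  have hτw : ∑ a, w 1 a * q 1 a = ∑ a, w 1 (τ a) * q 1 (τ a) :=
    (Equiv.sum_comp τ fun a => w 1 a * q 1 a).symm
  simp only [mul_sub, add_mul, sum_sub_distrib, sum_add_distrib, ← mul_sum] at hres₀ hres₁ hdiag
  rw [hτw] at hupper
  linarith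

end

/-! ### The monogamy relations -/

theorem monogamyRelation_of_free {mA mB d : ℕ} (σ : Fin mA → Fin mB → Equiv.Perm (Fin d))
    {μA : Fin mA → ℝ} {μB : Fin mB → ℝ} (hA : ∀ x, 0 ≤ μA x) (hB : ∀ y, 0 ≤ μB y) :
    MonogamyRelation (uniqueGame (fun x y => μA x * μB y) σ)
      (strongContradictionNumber (uniqueGame (fun x y => μA x * μB y) σ) + 1) :=
  monogamyRelation_of_hybridValue_le _ _ fun _ hS _ _ h _ _ _ _ hQ =>
    hybridValue_le_of_free hA hB hS h hQ

theorem proposition2 (mB d : ℕ) :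
    -- weights whose columns are proportional, with factors independent of Alice's setting
    (∀ (mA : ℕ) (σ : Fin mA → Fin mB → Equiv.Perm (Fin d)) (μ : Fin mA → Fin mB → ℝ)
        (β : Fin mB → Fin mB → ℝ),
        (∀ x y, 0 ≤ μ x y) → (∀ y y', 0 ≤ β y y') →
        (∀ x y y', μ x y = β y y' * μ x y') →
        MonogamyRelation (uniqueGame μ σ) (strongContradictionNumber (uniqueGame μ σ) + 1)) ∧
    -- free games
    (∀ (mA : ℕ) (σ : Fin mA → Fin mB → Equiv.Perm (Fin d)) (μA : Fin mA → ℝ) (μB : Fin mB → ℝ),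
        (∀ x, 0 ≤ μA x) → (∀ y, 0 ≤ μB y) →
        MonogamyRelation (uniqueGame (fun x y => μA x * μB y) σ)
          (strongContradictionNumber (uniqueGame (fun x y => μA x * μB y) σ) + 1)) ∧
    -- two settings for Alice, arbitrary weights
    (∀ (σ : Fin 2 → Fin mB → Equiv.Perm (Fin d)) (μ : Fin 2 → Fin mB → ℝ),
        (∀ x y, 0 ≤ μ x y) →
        MonogamyRelation (uniqueGame μ σ)
          (strongContradictionNumber (uniqueGame μ σ) + 1)) := by
  refine ⟨fun mA σ μ β hμ hβ hμβ => ?_, fun mA σ μA μB hA hB => monogamyRelation_of_free σ hA hB,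
    fun σ μ hμ => monogamyRelation_of_hybridValue_le _ _ fun S hS _ _ h Q q r m hQ =>
      hybridValue_le_of_two_settings hμ hS h hQ⟩
  rcases isEmpty_or_nonempty (Fin mB) with hB | ⟨⟨y₀⟩⟩
  · exact monogamyRelation_of_isEmpty _ _ (.inr (.inl hB))
  · have hfree : μ = fun x y => μ x y₀ * β y y₀ := by
      ext x y
      rw [hμβ x y y₀, mul_comm]
    rw [hfree]
    exact monogamyRelation_of_free σ (fun x => hμ x y₀) fun y => hβ y y₀
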